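/- Let $X$ be a Hausdorff, path-connected, locally path-connected and semilocally simply connected space whose fundamental group $\pi_1(X)$ is a free group of countably infinite rank. For a covering $p:E\to X$ write $A(E/X)$ for its group of deck transformations, i.e. homeomorphisms $f:E\to E$ with $p\circ f=p$; a (surjective) covering is called Galois if this group acts transitively on every fibre. Let $q:F\to X$ be a Galois covering with $F$ path-connected, let $H$ be a finite group and let $\phi:H\to A(F/X)$ be a surjective group homomorphism. Then there are a path-connected space $E$, Galois coverings $p:E\to X$ and $\pi:E\to F$ with $p=q\circ\pi$, and a group isomorphism $\psi:H\to A(E/X)$ such that $$\phi=\mathrm{res}_{E/F}\circ\psi .$$ Here $\mathrm{res}_{E/F}:A(E/X)\to A(F/X)$ is the restriction homomorphism: for a fixed point $e_0\in E$, $\mathrm{res}_{E/F}(\lambda)$ is the unique element of $A(F/X)$ with $\mathrm{res}_{E/F}(\lambda)(\pi(e_0))=\pi(\lambda(e_0))$; it satisfies $\mathrm{res}_{E/F}(\lambda)\circ\pi=\pi\circ\lambda$ and does not depend on $e_0$. -/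

import Mathlib

universe u v w

/-- Every point `x` has a neighbourhood `U` such that each loop at `x` inside `U` is
null-homotopic in `X`. -/
def IsSemilocallySimplyConnected (X : Type u) [TopologicalSpace X] : Prop :=
  ∀ x : X, ∃ U ∈ nhds x, ∀ γ : Path x x, (∀ t, γ t ∈ U) → γ.Homotopic (Path.refl x)

/-- The group `A(E/X)` of deck transformations of `p : E → X`: the self-homeomorphisms `f` of `E`
with `p ∘ f = p`, under composition. -/
def DeckGroup {E : Type u} {X : Type v} [TopologicalSpace E] (p : E → X) : Subgroup (E ≃ₜ E) where
  carrier := {f | ∀ e, p (f e) = p e}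
  mul_mem' {f g} hf hg e := (hf (g e)).trans (hg e)
  one_mem' _ := rfl
  inv_mem' {f} hf e := by
    have h := hf (f.symm e)
    rw [f.apply_symm_apply] at h
    exact h.symm

/-- A (surjective) covering map whose deck transformation group acts transitively on every
fibre. -/
structure IsGaloisCovering {E : Type u} {X : Type v} [TopologicalSpace E] [TopologicalSpace X]
    (p : E → X) : Prop where
  isCoveringMap : IsCoveringMap p
  surjective : Function.Surjective p
  transitive : ∀ e e' : E, p e = p e' → ∃ f ∈ DeckGroup p, f e = e'

section Restriction

variable {E : Type u} {F : Type v} {X : Type w}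
  [TopologicalSpace E] [TopologicalSpace F] [TopologicalSpace X]
  {p : E → X} {q : F → X} {π : E → F}

theorem IsGaloisCovering.exists_restriction (hq : IsGaloisCovering q) (hpq : p = q ∘ π) (e₀ : E)
    (l : DeckGroup p) : ∃ m : DeckGroup q, m.1 (π e₀) = π (l.1 e₀) := by
  obtain ⟨m, hm, h⟩ := hq.transitive (π e₀) (π (l.1 e₀)) (by
    have h : p (l.1 e₀) = p e₀ := l.2 e₀
    exact ((congrFun hpq (l.1 e₀)).symm.trans (h.trans (congrFun hpq e₀))).symm)
  exact ⟨⟨m, hm⟩, h⟩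

/-- A deck transformation of a connected covering is determined by its value at one point. -/
theorem IsGaloisCovering.deck_ext [PreconnectedSpace F] (hq : IsGaloisCovering q)
    {m m' : DeckGroup q} {a : F} (h : m.1 a = m'.1 a) : m = m' := by
  apply Subtype.ext
  apply Homeomorph.ext
  exact congrFun (hq.isCoveringMap.eq_of_comp_eq m.1.continuous m'.1.continuous
    (funext fun e => (m.2 e).trans (m'.2 e).symm) a h)

/-- The underlying function of the restriction: `res l` is the deck transformation of `q` sending
`π e₀` to `π (l e₀)`. -/
noncomputable def deckResFun (hq : IsGaloisCovering q) (hpq : p = q ∘ π) (e₀ : E)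
    (l : DeckGroup p) : DeckGroup q :=
  (hq.exists_restriction hpq e₀ l).choose

theorem deckResFun_base (hq : IsGaloisCovering q) (hpq : p = q ∘ π) (e₀ : E) (l : DeckGroup p) :
    (deckResFun hq hpq e₀ l).1 (π e₀) = π (l.1 e₀) :=
  (hq.exists_restriction hpq e₀ l).choose_spec

/-- The restriction square commutes: `res l ∘ π = π ∘ l`. -/
theorem deckResFun_apply [PreconnectedSpace E] (hπ : IsGaloisCovering π)
    (hq : IsGaloisCovering q) (hpq : p = q ∘ π) (e₀ : E) (l : DeckGroup p) (e : E) :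
    (deckResFun hq hpq e₀ l).1 (π e) = π (l.1 e) := by
  have hc := hπ.isCoveringMap.continuous
  refine congrFun (hq.isCoveringMap.eq_of_comp_eq
    (g₁ := fun e => (deckResFun hq hpq e₀ l).1 (π e)) (g₂ := fun e => π (l.1 e))
    (by fun_prop) (by fun_prop) (funext fun x => ?_) e₀ (deckResFun_base hq hpq e₀ l)) e
  have h : p (l.1 x) = p x := l.2 x
  have h' : q (π (l.1 x)) = q (π x) :=
    (congrFun hpq (l.1 x)).symm.trans (h.trans (congrFun hpq x))
  exact ((deckResFun hq hpq e₀ l).2 (π x)).trans h'.symm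

/-- The restriction homomorphism `res_{E/F} : A(E/X) → A(F/X)`, formed with the point `e₀`, for
Galois coverings `π : E → F` and `q : F → X` with `p = q ∘ π` and `E`, `F` path-connected. -/
noncomputable def deckRes [PathConnectedSpace E] [PathConnectedSpace F] (hπ : IsGaloisCovering π)
    (hq : IsGaloisCovering q) (hpq : p = q ∘ π) (e₀ : E) : DeckGroup p →* DeckGroup q where
  toFun := deckResFun hq hpq e₀
  map_one' := hq.deck_ext (deckResFun_base hq hpq e₀ 1)
  map_mul' l l' := hq.deck_ext (a := π e₀) (by
    have h := deckResFun_apply hπ hq hpq e₀ l (l'.1 e₀)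
    rw [← deckResFun_base hq hpq e₀ l'] at h
    exact (deckResFun_base hq hpq e₀ (l * l')).trans h.symm)

end Restriction

open Topology Filter unitInterval

/-! The covering `q` amounts to a surjection of the fundamental group onto `A(F/X)` (up to
opposites), and the theorem asks to lift it through `φ` to a surjection onto `H`. This embedding
problem is solvable because the group is free on infinitely many generators: infinitely many of them
have the same image, leaving room to hit the whole kernel of `φ`
(`FreeGroup.exists_surjective_lift`).

The lifted surjection is realised as the monodromy of a connected principal covering `E`
(`exists_isQuotientCoveringMap`), glued from locally constant transition functions. The lifting
criterion gives an equivariant map from `E` to `F` (`exists_equivariant_lift`), which is the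
quotient by `ker φ` (`ker_of_equivariant_lift`); equivariance is the restriction identity. -/

/-! ### Cocycles on the fundamental groupoid -/

/-- A map from homotopy classes of paths in `X` to a group `K` that turns concatenation of paths
into multiplication. -/
structure PathCocycle (X : Type u) [TopologicalSpace X] (K : Type v) [Group K] where
  toFun : ∀ {a b : X}, Path.Homotopic.Quotient a b → K
  map_trans : ∀ {a b c : X} (γ : Path.Homotopic.Quotient a b) (δ : Path.Homotopic.Quotient b c),
    toFun (γ.trans δ) = toFun γ * toFun δ

namespace PathCocycle

variable {X : Type u} [TopologicalSpace X] {K : Type v} [Group K] (R : PathCocycle X K)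

theorem map_refl (a : X) : R.toFun (Path.Homotopic.Quotient.refl a) = 1 := by
  have h := R.map_trans (Path.Homotopic.Quotient.refl a) (Path.Homotopic.Quotient.refl a)
  rw [Path.Homotopic.Quotient.trans_refl] at h
  exact left_eq_mul.mp h

theorem map_cast {a b a' b' : X} (γ : Path a b) (ha : a' = a) (hb : b' = b) :
    R.toFun (.mk (γ.cast ha hb)) = R.toFun (.mk γ) := by
  subst ha hb
  rfl

/-- The cocycle extending a homomorphism on the fundamental group at `x₀`, given a choice of path
classes from `x₀` to all points. -/
noncomputable def ofHom {x₀ : X} (ρ : FundamentalGroup X x₀ →* Kᵐᵒᵖ)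
    (τ : ∀ x : X, Path.Homotopic.Quotient x₀ x) : PathCocycle X K where
  toFun {a b} γ := (ρ (FundamentalGroup.fromPath (((τ a).trans γ).trans (τ b).symm))).unop
  map_trans {a b c} γ δ := by
    -- The product in `FundamentalGroup` reverses concatenation; the opposite group undoes this.
    rw [← MulOpposite.unop_mul, ← map_mul, FundamentalGroup.mul_def]
    congr 2
    change _ = (((τ a).trans γ).trans (τ b).symm).trans (((τ b).trans δ).trans (τ c).symm)
    simp only [Path.Homotopic.Quotient.trans_assoc]
    rw [← Path.Homotopic.Quotient.trans_assoc (τ b).symm (τ b),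
      Path.Homotopic.Quotient.symm_trans, Path.Homotopic.Quotient.refl_trans]

theorem ofHom_loop {x₀ : X} (ρ : FundamentalGroup X x₀ →* Kᵐᵒᵖ)
    (τ : ∀ x : X, Path.Homotopic.Quotient x₀ x) (hτ : τ x₀ = .refl x₀)
    (γ : FundamentalGroup X x₀) : (ofHom ρ τ).toFun γ.toPath = (ρ γ).unop := by
  change (ρ (FundamentalGroup.fromPath (((τ x₀).trans γ.toPath).trans (τ x₀).symm))).unop = _
  congr 2
  rw [hτ, Path.Homotopic.Quotient.refl_trans]
  exact Path.Homotopic.Quotient.trans_refl _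

end PathCocycle

/-! ### Good neighbourhoods and local values of a cocycle -/

theorem IsSemilocallySimplyConnected.exists_isOpen_isPathConnected {X : Type u}
    [TopologicalSpace X] [LocallyPathConnectedSpace X] (hX : IsSemilocallySimplyConnected X)
    (x : X) : ∃ V : Set X, IsOpen V ∧ x ∈ V ∧ IsPathConnected V ∧
      ∀ (y : X) (γ δ : Path x y), (∀ t, γ t ∈ V) → (∀ t, δ t ∈ V) → γ.Homotopic δ := by
  obtain ⟨U, hU, h⟩ := hX x
  refine ⟨pathComponentIn (interior U) x, isOpen_interior.pathComponentIn x,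
    mem_pathComponentIn_self (mem_interior_iff_mem_nhds.mpr hU),
    isPathConnected_pathComponentIn (mem_interior_iff_mem_nhds.mpr hU), fun y γ δ hγ hδ => ?_⟩
  have hsub : pathComponentIn (interior U) x ⊆ U :=
    pathComponentIn_subset.trans interior_subset
  have hl := h (γ.trans δ.symm) fun t => hsub <| by
    have ht : γ.trans δ.symm t ∈ Set.range (γ.trans δ.symm) := ⟨t, rfl⟩
    rw [Path.trans_range, Path.symm_range] at ht
    rcases ht with ⟨s, hs⟩ | ⟨s, hs⟩
    · exact hs ▸ hγ s
    · exact hs ▸ hδ s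
  rw [← Path.Homotopic.Quotient.eq] at hl ⊢
  have := congrArg (fun q => q.trans (.mk δ)) hl
  simpa using this

/-- A path-connected open neighbourhood of `x` in which paths starting at `x` are determined up to
homotopy in `X` by their end points. -/
noncomputable def IsSemilocallySimplyConnected.nbhd {X : Type u} [TopologicalSpace X]
    [LocallyPathConnectedSpace X] (hX : IsSemilocallySimplyConnected X) (x : X) : Set X :=
  (hX.exists_isOpen_isPathConnected x).choose

namespace PathCocycle

variable {X : Type u} [TopologicalSpace X] [LocallyPathConnectedSpace X] {K : Type v} [Group K]
  (R : PathCocycle X K) (hX : IsSemilocallySimplyConnected X)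

open Classical in
/-- The value of the cocycle on paths from `i` to `y` inside the chosen neighbourhood of `i`. -/
noncomputable def localValue (i y : X) : K :=
  if h : JoinedIn (hX.nbhd i) i y then R.toFun (.mk h.somePath) else 1

theorem isOpen_nbhd (i : X) : IsOpen (hX.nbhd i) :=
  (hX.exists_isOpen_isPathConnected i).choose_spec.1

theorem mem_nbhd (i : X) : i ∈ hX.nbhd i :=
  (hX.exists_isOpen_isPathConnected i).choose_spec.2.1

theorem joinedIn_nbhd {i y : X} (hy : y ∈ hX.nbhd i) : JoinedIn (hX.nbhd i) i y :=
  (hX.exists_isOpen_isPathConnected i).choose_spec.2.2.1.joinedIn i (mem_nbhd hX i) y hy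

theorem localValue_eq {i y : X} (γ : Path i y) (hγ : ∀ t, γ t ∈ hX.nbhd i) :
    R.localValue hX i y = R.toFun (.mk γ) := by
  have h : JoinedIn (hX.nbhd i) i y := ⟨γ, hγ⟩
  rw [localValue, dif_pos h]
  congr 1
  exact Path.Homotopic.Quotient.eq.mpr <|
    (hX.exists_isOpen_isPathConnected i).choose_spec.2.2.2 y _ _ h.somePath_mem hγ

theorem localValue_mul {i y z : X} (hy : y ∈ hX.nbhd i) (γ : Path y z)
    (hγ : ∀ t, γ t ∈ hX.nbhd i) :
    R.localValue hX i z = R.localValue hX i y * R.toFun (.mk γ) := by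
  obtain ⟨δ, hδ⟩ := joinedIn_nbhd hX hy
  rw [R.localValue_eq hX δ hδ, R.localValue_eq hX (δ.trans γ),
    Path.Homotopic.Quotient.mk_trans, R.map_trans]
  intro t
  have ht : δ.trans γ t ∈ Set.range (δ.trans γ) := ⟨t, rfl⟩
  rw [Path.trans_range] at ht
  rcases ht with ⟨s, hs⟩ | ⟨s, hs⟩
  · exact hs ▸ hδ s
  · exact hs ▸ hγ s

/-- Moving along a path in the intersection multiplies both local values on the right by the same
element, which cancels. This local constancy makes the transition functions continuous. -/
theorem localValue_transition_eventuallyEq {i j y : X} (hi : y ∈ hX.nbhd i)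
    (hj : y ∈ hX.nbhd j) :
    ∀ᶠ z in 𝓝 y, R.localValue hX i z * (R.localValue hX j z)⁻¹ =
      R.localValue hX i y * (R.localValue hX j y)⁻¹ := by
  have hopen := (isOpen_nbhd hX i).inter (isOpen_nbhd hX j)
  filter_upwards [(hopen.pathComponentIn y).mem_nhds (mem_pathComponentIn_self ⟨hi, hj⟩)]
    with z hz
  obtain ⟨γ, hγ⟩ : JoinedIn (hX.nbhd i ∩ hX.nbhd j) y z := hz
  rw [R.localValue_mul hX hi γ fun t => (hγ t).1, R.localValue_mul hX hj γ fun t => (hγ t).2]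
  group

theorem localValue_self (i : X) : R.localValue hX i i = 1 := by
  rw [R.localValue_eq hX (Path.refl i) fun _ => mem_nbhd hX i]
  exact R.map_refl i

/-! ### The principal covering of a cocycle -/

variable [TopologicalSpace K] [DiscreteTopology K]

/-- The principal bundle with discrete structure group `K` whose monodromy is the cocycle `R`. -/
noncomputable def core : FiberBundleCore X X K where
  baseSet := hX.nbhd
  isOpen_baseSet := isOpen_nbhd hX
  indexAt x := x
  mem_baseSet_at := mem_nbhd hX
  -- Transitions multiply on the right, so left multiplication by `K` is globally defined.
  coordChange i j y k := k * (R.localValue hX i y * (R.localValue hX j y)⁻¹)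
  coordChange_self i y _ k := by simp
  continuousOn_coordChange i j := by
    rintro ⟨y, k⟩ ⟨⟨hi, hj⟩, -⟩
    refine ContinuousAt.continuousWithinAt (continuousAt_snd.mul ?_)
    refine ContinuousAt.comp (f := Prod.fst)
      (g := fun z => R.localValue hX i z * (R.localValue hX j z)⁻¹) ?_ continuousAt_fst
    exact continuousAt_const.congr
      ((R.localValue_transition_eventuallyEq hX hi hj).mono fun z hz => hz.symm)
  coordChange_comp i j l y _ k := by group

/-- The point with coordinate `k` in the fibre over `x`. -/
def point (x : X) (k : K) : (R.core hX).TotalSpace := ⟨x, k⟩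

/-- The coordinate of a point in its fibre. -/
def coord (e : (R.core hX).TotalSpace) : K := e.2

noncomputable instance : MulAction K (R.core hX).TotalSpace where
  smul h e := R.point hX e.1 (h * R.coord hX e)
  one_smul e := by
    change R.point hX e.1 (1 * R.coord hX e) = e
    rw [one_mul]
    rfl
  mul_smul h h' e := by
    change R.point hX e.1 (h * h' * R.coord hX e) = R.point hX e.1 (h * (h' * R.coord hX e))
    rw [mul_assoc]

theorem smul_point (h : K) (x : X) (k : K) : h • R.point hX x k = R.point hX x (h * k) := rfl

theorem exists_eq_point (e : (R.core hX).TotalSpace) : ∃ k, e = R.point hX e.1 k := ⟨e.2, rfl⟩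

theorem localTriv_point (i x : X) (k : K) : (R.core hX).localTriv i (R.point hX x k) =
    (x, k * (R.localValue hX i x)⁻¹) := by
  change (x, k * (R.localValue hX x x * (R.localValue hX i x)⁻¹)) = _
  rw [localValue_self, one_mul]

theorem localTriv_symm (i x : X) (k : K) :
    ((R.core hX).localTriv i).toOpenPartialHomeomorph.symm (x, k) =
    R.point hX x (k * R.localValue hX i x) := by
  change R.point hX x (k * (R.localValue hX i x * (R.localValue hX x x)⁻¹)) = _
  rw [localValue_self, inv_one, mul_one]

theorem continuousOn_localSection (i : X) (k : K) :
    ContinuousOn (fun y => R.point hX y (k * R.localValue hX i y)) (hX.nbhd i) := by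
  have h := ((R.core hX).localTriv i).toOpenPartialHomeomorph.continuousOn_symm
  refine (h.comp (f := fun y => (y, k)) (by fun_prop) fun y hy => ?_).congr fun y _ => ?_
  · exact ((R.core hX).mem_localTriv_target i (y, k)).mpr hy
  · exact (R.localTriv_symm hX i y k).symm

instance : ContinuousConstSMul K (R.core hX).TotalSpace where
  continuous_const_smul h := by
    refine continuous_iff_continuousAt.mpr fun e => ?_
    let φ := (R.core hX).localTriv e.1
    have he : e ∈ φ.source := ((R.core hX).mem_localTriv_source e.1 e).mpr (mem_nbhd hX e.1)
    have hc : ContinuousOn (fun e' => φ.toOpenPartialHomeomorph.symm ((φ e').1, h * (φ e').2))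
        φ.source := by
      refine φ.toOpenPartialHomeomorph.continuousOn_symm.comp ?_ ?_
      · have := φ.continuousOn
        fun_prop
      · intro e' he'
        have := φ.map_source he'
        rw [φ.target_eq] at this
        exact φ.target_eq ▸ ⟨this.1, trivial⟩
    refine (hc.continuousAt (φ.open_source.mem_nhds he)).congr ?_
    filter_upwards [φ.open_source.mem_nhds he] with e' _
    obtain ⟨k, hk⟩ := R.exists_eq_point hX e'
    rw [hk]
    simp only [φ, localTriv_point, localTriv_symm, smul_point]
    group

theorem isQuotientCoveringMap_core : IsQuotientCoveringMap (R.core hX).proj K := by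
  refine (isQuotientCoveringMap_iff_isCoveringMap_and _ _).mpr
    ⟨FiberBundle.isCoveringMap, fun x => ⟨R.point hX x 1, rfl⟩, inferInstance,
      ⟨fun a b e h => ?_⟩, fun {e₁ e₂} => ⟨fun h => ?_, ?_⟩⟩
  · obtain ⟨k, hk⟩ := R.exists_eq_point hX e
    rw [hk, smul_point, smul_point] at h
    exact mul_right_cancel (congrArg (R.coord hX) h)
  · obtain ⟨k₁, hk₁⟩ := R.exists_eq_point hX e₁
    obtain ⟨k₂, hk₂⟩ := R.exists_eq_point hX e₂
    refine ⟨k₁ * k₂⁻¹, ?_⟩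
    change (k₁ * k₂⁻¹) • e₂ = e₁
    have h' : e₁.1 = e₂.1 := h
    rw [hk₁, hk₂, smul_point, inv_mul_cancel_right, ← h']
  · rintro ⟨h, rfl⟩
    rfl

/-! ### Path lifting and monodromy -/

/-- Near time `s` the formula agrees with a local section over the neighbourhood of `γ s`, since the
subpath from `0` to `t` is homotopic to the one through `s`. -/
theorem continuous_lift {a b : X} (γ : Path a b) (k : K) :
    Continuous fun t => R.point hX (γ t) (k * R.toFun (.mk (γ.subpath 0 t))) := by
  refine continuous_iff_continuousAt.mpr fun s => ?_
  have hs : γ ⁻¹' hX.nbhd (γ s) ∈ 𝓝 s :=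
    γ.continuous.continuousAt.preimage_mem_nhds
      ((isOpen_nbhd hX _).mem_nhds (mem_nbhd hX _))
  have hc : ContinuousAt (fun t => R.point hX (γ t)
      (k * R.toFun (.mk (γ.subpath 0 s)) * R.localValue hX (γ s) (γ t))) s :=
    ContinuousAt.comp (f := γ) ((R.continuousOn_localSection hX (γ s) _).continuousAt
      ((isOpen_nbhd hX _).mem_nhds (mem_nbhd hX _))) γ.continuous.continuousAt
  refine hc.congr ?_
  have hI : Tendsto (fun t => Set.uIcc s t) (𝓝 s) (𝓝 s).smallSets :=
    tendsto_const_nhds.uIcc tendsto_id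
  filter_upwards [hI.eventually (eventually_smallSets_subset.mpr hs)] with t ht
  congr 1
  rw [R.localValue_eq hX (γ.subpath s t), mul_assoc, ← R.map_trans,
    ← Path.Homotopic.Quotient.mk_trans,
    Path.Homotopic.Quotient.eq.mpr ⟨Path.Homotopy.subpathTransSubpath γ 0 s t⟩]
  intro r
  have hr : γ.subpath s t r ∈ Set.range (γ.subpath s t) := ⟨r, rfl⟩
  rw [Path.range_subpath] at hr
  obtain ⟨q, hq, hqr⟩ := hr
  rw [← hqr]
  exact ht hq

/-- The lift of a path starting at the point with coordinate `k`. -/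
def lift {a b : X} (γ : Path a b) (k : K) :
    Path (R.point hX a k) (R.point hX b (k * R.toFun (.mk γ))) where
  toFun t := R.point hX (γ t) (k * R.toFun (.mk (γ.subpath 0 t)))
  continuous_toFun := R.continuous_lift hX γ k
  source' := by
    rw [Path.subpath_self, Path.Homotopic.Quotient.mk_refl, R.map_refl, mul_one, γ.source]
  target' := by
    rw [Path.subpath_zero_one, R.map_cast, γ.target]

theorem monodromy_core {a b : X} (γ : Path.Homotopic.Quotient a b) (k : K) :
    (R.isQuotientCoveringMap_core hX).isCoveringMap.monodromy γ ⟨R.point hX a k, rfl⟩ =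
      ⟨R.point hX b (k * R.toFun γ), rfl⟩ := by
  induction γ with | mk γ =>
  exact (R.isQuotientCoveringMap_core hX).isCoveringMap.monodromy_eq_of_map_eq
    (Path.Homotopic.Quotient.mk (R.lift hX γ k)) rfl

theorem pathConnectedSpace_core [PathConnectedSpace X] (x₀ : X)
    (h : ∀ k, ∃ γ : Path x₀ x₀, R.toFun (.mk γ) = k) :
    PathConnectedSpace (R.core hX).TotalSpace := by
  refine pathConnectedSpace_iff_eq.mpr ⟨R.point hX x₀ 1, ?_⟩
  refine Set.eq_univ_of_forall fun e => ?_
  obtain ⟨k, hk⟩ := R.exists_eq_point hX e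
  let τ := PathConnectedSpace.somePath x₀ e.1
  -- The loop is chosen so that the lift of `γ` followed by `τ` ends at coordinate `k`.
  obtain ⟨γ, hγ⟩ := h (k * (R.toFun (.mk τ))⁻¹)
  have := R.lift hX (γ.trans τ) 1
  rw [Path.Homotopic.Quotient.mk_trans, R.map_trans, hγ, inv_mul_cancel_right, one_mul,
    ← hk] at this
  exact ⟨this⟩

end PathCocycle

open Classical in
theorem IsSemilocallySimplyConnected.exists_isQuotientCoveringMap {X : Type u}
    [TopologicalSpace X] [PathConnectedSpace X] [LocallyPathConnectedSpace X]
    (hX : IsSemilocallySimplyConnected X) {x₀ : X} {K : Type u} [Group K]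
    (ρ : FundamentalGroup X x₀ →* Kᵐᵒᵖ) (hρ : Function.Surjective ρ) :
    ∃ (E : Type u) (_ : TopologicalSpace E) (_ : PathConnectedSpace E) (_ : MulAction K E)
      (p : E → X) (hp : IsQuotientCoveringMap p K) (e₀ : p ⁻¹' {x₀}),
      hp.fundamentalGroupToMulOpposite e₀ = ρ := by
  let _ : TopologicalSpace K := ⊥
  have : DiscreteTopology K := ⟨rfl⟩
  -- The constant path is forced at `x₀` so that the monodromy is `ρ` itself, not a conjugate.
  let τ : ∀ x : X, Path.Homotopic.Quotient x₀ x := fun x =>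
    if h : x = x₀ then (Path.Homotopic.Quotient.refl x₀).cast rfl h
    else .mk (PathConnectedSpace.somePath x₀ x)
  have hτ : τ x₀ = .refl x₀ := by simp [τ]
  let R := PathCocycle.ofHom ρ τ
  have hR := PathCocycle.ofHom_loop ρ τ hτ
  refine ⟨(R.core hX).TotalSpace, inferInstance, R.pathConnectedSpace_core hX x₀ fun k => ?_,
    inferInstance, (R.core hX).proj, R.isQuotientCoveringMap_core hX, ⟨R.point hX x₀ 1, rfl⟩, ?_⟩
  · obtain ⟨γ, hγ⟩ := hρ (.op k)
    obtain ⟨γ', hγ'⟩ := Path.Homotopic.Quotient.mk_surjective γ.toPath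
    refine ⟨γ', ?_⟩
    rw [hγ', hR, hγ]
    rfl
  · ext γ
    rw [IsQuotientCoveringMap.fundamentalGroupToMulOpposite_apply_eq_Iff, R.monodromy_core hX,
      ← hR γ]
    change _ • R.point hX x₀ 1 = R.point hX x₀ _
    rw [PathCocycle.smul_point, mul_one, one_mul]

/-! ### A finite embedding problem for free groups -/

/-- By pigeonhole infinitely many generators share an image `a`. Their lifts may differ by arbitrary
elements of the finite kernel, so the image contains the kernel; as it also maps onto `A`, it is all
of `H`. -/
theorem FreeGroup.exists_surjective_lift {α : Type*} [Infinite α] {H A : Type*} [Group H]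
    [Finite H] [Group A] (φ : H →* A) (hφ : Function.Surjective φ) (ρ : FreeGroup α →* A)
    (hρ : Function.Surjective ρ) :
    ∃ ρ' : FreeGroup α →* H, Function.Surjective ρ' ∧ φ.comp ρ' = ρ := by
  classical
  have : Finite A := Finite.of_surjective φ hφ
  obtain ⟨a, ha⟩ := Finite.exists_infinite_fiber fun x => ρ (FreeGroup.of x)
  let S := (fun x => ρ (FreeGroup.of x)) ⁻¹' {a}
  have hS : Infinite S := ha
  let s := Function.surjInv hφ
  have hs : ∀ b, φ (s b) = b := Function.surjInv_eq hφ
  let ι : φ.ker → S := fun k => Infinite.natEmbedding S (Finite.equivFin φ.ker k)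
  have hι : Function.Injective ι := (Infinite.natEmbedding S).injective.comp
    (Fin.val_injective.comp (Finite.equivFin φ.ker).injective)
  -- Outside the range of `ι`, `invFun` returns some arbitrary kernel element, which does not affect
  -- the image under `φ`.
  let f : α → H := fun x =>
    if hx : x ∈ S then s a * (Function.invFun ι ⟨x, hx⟩ : φ.ker) else s (ρ (FreeGroup.of x))
  have hf : ∀ k : φ.ker, f (ι k) = s a * k := fun k => by
    simp only [f, Subtype.coe_prop, dif_pos, Subtype.coe_eta]
    rw [Function.leftInverse_invFun hι k]
  have hcomp : φ.comp (FreeGroup.lift f) = ρ := by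
    ext x
    rw [MonoidHom.comp_apply, FreeGroup.lift_apply_of]
    by_cases hx : x ∈ S
    · have hk := (Function.invFun ι ⟨x, hx⟩ : φ.ker).2
      rw [MonoidHom.mem_ker] at hk
      simp only [f, dif_pos hx, _root_.map_mul, hk, mul_one, hs]
      exact hx.symm
    · simp only [f, dif_neg hx, hs]
  have hker : ∀ k : φ.ker, ∃ y, FreeGroup.lift f y = k := fun k =>
    ⟨(FreeGroup.of (ι 1 : α))⁻¹ * FreeGroup.of (ι k : α), by
      rw [_root_.map_mul, _root_.map_inv, FreeGroup.lift_apply_of, FreeGroup.lift_apply_of, hf, hf]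
      simp⟩
  refine ⟨FreeGroup.lift f, fun h => ?_, hcomp⟩
  obtain ⟨y, hy⟩ := hρ (φ h)
  obtain ⟨z, hz⟩ := hker ⟨(FreeGroup.lift f y)⁻¹ * h, by
    rw [MonoidHom.mem_ker, _root_.map_mul, _root_.map_inv, ← MonoidHom.comp_apply, hcomp, hy, inv_mul_cancel]⟩
  exact ⟨y * z, by rw [_root_.map_mul, hz, mul_inv_cancel_left]⟩

/-! ### Galois coverings as quotient coverings, and maps between them -/

theorem IsLocalHomeomorph.locallyPathConnectedSpace {E : Type u} {X : Type v} [TopologicalSpace E]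
    [TopologicalSpace X] [LocallyPathConnectedSpace X] {p : E → X} (hp : IsLocalHomeomorph p) :
    LocallyPathConnectedSpace E :=
  let _ : ChartedSpace X E :=
    { atlas := Set.univ
      chartAt := fun e => (hp e).choose
      mem_chart_source := fun e => (hp e).choose_spec.1
      chart_mem_atlas := fun _ => trivial }
  ChartedSpace.locallyPathConnectedSpace X E

instance {E : Type u} {X : Type v} [TopologicalSpace E] (p : E → X) :
    MulAction (DeckGroup p) E where
  smul f e := f.1 e
  one_smul _ := rfl
  mul_smul _ _ _ := rfl

theorem IsGaloisCovering.isQuotientCoveringMap {E : Type u} {X : Type v} [TopologicalSpace E]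
    [TopologicalSpace X] [PreconnectedSpace E] {p : E → X} (hp : IsGaloisCovering p) :
    IsQuotientCoveringMap p (DeckGroup p) := by
  refine (isQuotientCoveringMap_iff_isCoveringMap_and _ _).mpr
    ⟨hp.isCoveringMap, hp.surjective, ⟨fun f => f.1.continuous⟩,
      ⟨fun f g e h => hp.deck_ext h⟩, fun {e₁ e₂} => ⟨fun h => ?_, ?_⟩⟩
  · obtain ⟨f, hf, h⟩ := hp.transitive e₂ e₁ h.symm
    exact ⟨⟨f, hf⟩, h⟩
  · rintro ⟨f, rfl⟩
    exact f.2 e₂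

namespace IsQuotientCoveringMap

variable {E : Type u} {X : Type v} [TopologicalSpace E] [TopologicalSpace X] {p : E → X}
  {K : Type w} [Group K] [MulAction K E]

/-- The group of a quotient covering acts by deck transformations. -/
def toDeckGroup (hp : IsQuotientCoveringMap p K) : K →* DeckGroup p :=
  have := hp.toContinuousConstSMul
  { toFun := fun k => ⟨Homeomorph.smul k, fun _ => hp.map_smul k⟩
    map_one' := Subtype.ext (Homeomorph.ext fun e => one_smul K e)
    map_mul' := fun k l => Subtype.ext (Homeomorph.ext fun e => mul_smul k l e) }

theorem toDeckGroup_apply (hp : IsQuotientCoveringMap p K) (k : K) (e : E) :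
    (hp.toDeckGroup k).1 e = k • e := rfl

theorem isGaloisCovering (hp : IsQuotientCoveringMap p K) : IsGaloisCovering p where
  isCoveringMap := hp.isCoveringMap
  surjective := hp.surjective
  transitive e e' h := by
    obtain ⟨k, hk⟩ := hp.apply_eq_iff_mem_orbit.mp h.symm
    exact ⟨hp.toDeckGroup k, (hp.toDeckGroup k).2, hk⟩

theorem toDeckGroup_bijective [PathConnectedSpace E] (hp : IsQuotientCoveringMap p K) :
    Function.Bijective hp.toDeckGroup := by
  obtain ⟨e⟩ := (inferInstance : Nonempty E)
  refine ⟨fun k l h => ?_, fun f => ?_⟩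
  · have := hp.isCancelSMul
    exact IsCancelSMul.right_cancel k l e (congrArg (fun f : DeckGroup p => f.1 e) h)
  · obtain ⟨k, hk⟩ := hp.apply_eq_iff_mem_orbit.mp (f.2 e)
    exact ⟨k, hp.isGaloisCovering.deck_ext (a := e) hk⟩

variable {F : Type*} [TopologicalSpace F] {q : F → X} {A : Type*} [Group A] [MulAction A F]

/-- A homomorphism of structure groups compatible with the monodromy homomorphisms is induced by an
equivariant map of coverings. -/
theorem exists_equivariant_lift [PathConnectedSpace E] [LocallyPathConnectedSpace E]
    (hp : IsQuotientCoveringMap p K) (hq : IsQuotientCoveringMap q A) (φ : K →* A) {x : X}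
    (e₀ : p ⁻¹' {x}) (f₀ : q ⁻¹' {x})
    (h : φ.op.comp (hp.fundamentalGroupToMulOpposite e₀) = hq.fundamentalGroupToMulOpposite f₀) :
    ∃ π : E → F, Continuous π ∧ q ∘ π = p ∧ ∀ (k : K) (e : E), π (k • e) = φ k • π e := by
  obtain ⟨e₀, rfl⟩ := e₀
  have hcp := hp.isCoveringMap
  have hcq := hq.isCoveringMap
  -- The lifting criterion: a loop that lifts to a loop in `E` has trivial monodromy for `p`, hence
  -- by `h` also for `q`.
  have hle : (FundamentalGroup.map ⟨p, hcp.continuous⟩ e₀).range ≤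
      (FundamentalGroup.mapOfEq ⟨q, hcq.continuous⟩ f₀.2).range := by
    rintro _ ⟨Γ, rfl⟩
    rw [← hq.ker_monodromyPerm f₀, ← hq.ker_fundamentalGroupToMulOpposite f₀, MonoidHom.mem_ker,
      ← h, MonoidHom.comp_apply]
    have := (hp.fundamentalGroupToMulOpposite_eq_one_iff (e := ⟨e₀, rfl⟩)
      (γ := FundamentalGroup.map ⟨p, hcp.continuous⟩ e₀ Γ)).mpr (hcp.monodromy_map Γ.toPath)
    rw [this, map_one]
  obtain ⟨π, ⟨hπ₀, hπ⟩, -⟩ := hcq.existsUnique_continuousMap_lifts_of_range_le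
    (f := ⟨p, hcp.continuous⟩) (a₀ := e₀) (e₀ := f₀.1) f₀.2 hle
  replace hπ : q ∘ π = p := hπ
  refine ⟨π, π.continuous, hπ, fun k e => ?_⟩
  have hk := hp.toContinuousConstSMul
  have hk' := hq.toContinuousConstSMul
  -- Both sides lift `p` through `q`, so it suffices to compare them at `e₀`, where `k` is the
  -- monodromy of some loop.
  refine congrFun (hcq.eq_of_comp_eq (g₁ := fun e => π (k • e)) (g₂ := fun e => φ k • π e)
    (by fun_prop) (by fun_prop) (funext fun e => ?_) e₀ ?_) e
  · exact (congrFun hπ (k • e)).trans ((hp.map_smul k).trans ((congrFun hπ e).symm.trans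
      (hq.map_smul (φ k)).symm))
  · obtain ⟨γ, hγ⟩ := hp.fundamentalGroupToMulOpposite_surjective ⟨e₀, rfl⟩ (.op k)
    have hke := hp.unop_fundamentalGroupToMulOpposite_smul (e := ⟨e₀, rfl⟩) (γ := γ)
    have hkf := hq.unop_fundamentalGroupToMulOpposite_smul (e := f₀) (γ := γ)
    rw [hγ] at hke
    rw [← h, MonoidHom.comp_apply, hγ] at hkf
    change k • e₀ = _ at hke
    change φ k • f₀.1 = _ at hkf
    change π (k • e₀) = φ k • π e₀
    rw [hπ₀, hkf, hke]
    obtain ⟨γ, rfl⟩ := Path.Homotopic.Quotient.mk_surjective γ.toPath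
    change π (hcp.liftPath γ e₀ _ 1) = hcq.liftPath γ f₀.1 _ 1
    have := (hcq.eq_liftPath_iff' (γ.source.trans f₀.2.symm)
      (Γ := π.comp (hcp.liftPath γ e₀ γ.source))).mpr
      ⟨by
        rw [ContinuousMap.coe_comp, ← Function.comp_assoc, hπ]
        exact hcp.liftPath_lifts _ _ _, by
        rw [ContinuousMap.comp_apply, hcp.liftPath_zero, hπ₀]⟩
    exact congrArg (fun g : C(I, F) => g 1) this

/-- Two points of a fibre of `π` differ by some `k`, and `φ k` fixes their image; since `A` acts
freely, `k` lies in the kernel. -/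
theorem ker_of_equivariant_lift (hp : IsQuotientCoveringMap p K) (hq : IsQuotientCoveringMap q A)
    (φ : K →* A) (hφ : Function.Surjective φ) {π : E → F} (hc : Continuous π) (hπ : q ∘ π = p)
    (h : ∀ (k : K) (e : E), π (k • e) = φ k • π e) : IsQuotientCoveringMap π φ.ker := by
  have hsurj : Function.Surjective π := fun f => by
    obtain ⟨e, he⟩ := hp.surjective (q f)
    obtain ⟨a, ha⟩ := hq.apply_eq_iff_mem_orbit.mp (he.symm.trans (congrFun hπ e).symm)
    obtain ⟨k, rfl⟩ := hφ a
    exact ⟨k • e, (h k e).trans ha⟩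
  have hloc : IsLocalHomeomorph π := by
    refine IsLocalHomeomorph.of_comp (g := q) ?_ hq.isCoveringMap.isLocalHomeomorph hc
    rw [hπ]
    exact hp.isCoveringMap.isLocalHomeomorph
  have := hq.isCancelSMul
  refine (isQuotientCoveringMap_iff _ _).mpr ⟨hloc.isOpenMap.isQuotientMap hc hsurj,
    ⟨fun k => hp.continuous_const_smul k.1⟩, fun {e₁ e₂} => ⟨fun he => ?_, ?_⟩, fun e => ?_⟩
  · obtain ⟨k, rfl⟩ := hp.apply_eq_iff_mem_orbit.mp
      ((congrFun hπ e₁).symm.trans ((congrArg q he).trans (congrFun hπ e₂)))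
    refine ⟨⟨k, IsCancelSMul.right_cancel _ _ (π e₂) ?_⟩, rfl⟩
    rw [one_smul]
    exact (h k e₂).symm.trans he
  · rintro ⟨k, rfl⟩
    change π (k.1 • e₂) = π e₂
    rw [h, k.2, one_smul]
  · obtain ⟨U, hU, hd⟩ := hp.disjoint e
    exact ⟨U, hU, fun k hk => Subtype.ext (hd k.1 hk)⟩

end IsQuotientCoveringMap

/-! ### Assembly -/

theorem mainTheorem1 {X : Type u} [TopologicalSpace X] [T2Space X] [PathConnectedSpace X]
    [LocallyPathConnectedSpace X] (hX : IsSemilocallySimplyConnected X) (x₀ : X)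
    (hfree : Nonempty (FundamentalGroup X x₀ ≃* FreeGroup ℕ))
    {F : Type v} [TopologicalSpace F] [PathConnectedSpace F] (q : F → X) (hq : IsGaloisCovering q)
    {H : Type w} [Group H] [Finite H] (φ : H →* DeckGroup q) (hφ : Function.Surjective φ) :
    ∃ (E : Type u) (_ : TopologicalSpace E) (_ : PathConnectedSpace E) (p : E → X) (π : E → F)
      (_ : IsGaloisCovering p) (hπ : IsGaloisCovering π) (hpq : p = q ∘ π)
      (ψ : H ≃* DeckGroup p),
      ∀ e₀ : E, φ = (deckRes hπ hq hpq e₀).comp ψ.toMonoidHom := by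
  obtain ⟨α⟩ := hfree
  have hqQ := hq.isQuotientCoveringMap
  obtain ⟨f₀, hf₀⟩ := hq.surjective x₀
  -- A copy of the finite group `H` in the universe of `X`, so that `E` lives there too.
  let ε : Shrink.{u} H ≃* H := Shrink.mulEquiv
  let φ' : Shrink.{u} H →* DeckGroup q := φ.comp ε.toMonoidHom
  have hφ' : Function.Surjective φ' := hφ.comp ε.surjective
  have : Finite (Shrink.{u} H)ᵐᵒᵖ := Finite.of_equiv H (ε.symm.toEquiv.trans MulOpposite.opEquiv)
  let ρq := hqQ.fundamentalGroupToMulOpposite (x := x₀) ⟨f₀, hf₀⟩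
  obtain ⟨ρ, hρ, hρφ⟩ := FreeGroup.exists_surjective_lift φ'.op
    (fun a => (hφ' a.unop).imp' MulOpposite.op fun k hk => congrArg MulOpposite.op hk)
    (ρq.comp α.symm.toMonoidHom)
    ((hqQ.fundamentalGroupToMulOpposite_surjective _).comp α.symm.surjective)
  obtain ⟨E, _, _, _, p, hp, e₀, he₀⟩ := hX.exists_isQuotientCoveringMap
    (ρ.comp α.toMonoidHom) (hρ.comp α.surjective)
  have := hp.isCoveringMap.isLocalHomeomorph.locallyPathConnectedSpace
  obtain ⟨π, hc, hπ, hequiv⟩ := hp.exists_equivariant_lift hqQ φ' e₀ ⟨f₀, hf₀⟩ (by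
    rw [he₀, ← MonoidHom.comp_assoc, hρφ]
    ext γ
    simp [ρq])
  have hπQ := hp.ker_of_equivariant_lift hqQ φ' hφ' hc hπ hequiv
  refine ⟨E, inferInstance, inferInstance, p, π, hp.isGaloisCovering, hπQ.isGaloisCovering,
    hπ.symm, ε.symm.trans (MulEquiv.ofBijective hp.toDeckGroup hp.toDeckGroup_bijective),
    fun e => MonoidHom.ext fun h => hq.deck_ext (a := π e) ?_⟩
  refine Eq.trans ?_ (deckResFun_base hq hπ.symm e (hp.toDeckGroup (ε.symm h))).symm
  rw [IsQuotientCoveringMap.toDeckGroup_apply, hequiv]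
  change _ = (φ (ε (ε.symm h))).1 (π e)
  rw [ε.apply_symm_apply]
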